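/- **Setting.** For every number $n$ of qubits write a Hermitian observable $H=H_n$ in the Pauli basis as $H=\sum_{\alpha\in\{0,1,2,3\}^n}c_\alpha P_\alpha$ with $c_\alpha\in\mathbb R$, $P_\alpha=\bigotimes_i\sigma_{\alpha_i}$ and $\sigma_0,\dots,\sigma_3=I,X,Y,Z$. Call the family $(H_n)$ *mixed* if there are a constant $k$ and, for all large $n$, an index $\alpha=\alpha(n)$ with $1\le|\{i:\alpha_i\ne0\}|\le k$ such that $|c_{\alpha(n)}|\in\Omega(1/\mathrm{poly}(n))$; no other condition is placed on the remaining coefficients. Here $f(n)\in\Omega(1/\mathrm{poly}(n))$ means that $f(n)\ge C/n^{p}$ for some $C>0$, $p\in\mathbb N$ and all large $n$. Let $\rho=|0\rangle\langle0|^{\otimes n}$, and let $$U(\theta)=R_dE\,R_{d-1}E\cdots R_1E\,R_0$$ (the rightmost factor acts first) be the EfficientSU2 circuit of depth $d=d(n)$, or this circuit followed by one more entangling layer $E$ (that is, with the final rotation layer skipped). Here each rotation layer $R_l$ applies to every qubit $i$ the gate $R_Y(\theta_{l,i,0})=e^{-i\theta_{l,i,0}Y/2}$ and then the gate $R_Z(\theta_{l,i,1})=e^{-i\theta_{l,i,1}Z/2}$,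 all the parameters being distinct, and the pairwise entangling layer $E$ applies CNOT gates, with control $i$ and target $i+1$, first to the pairs of qubits $(0,1),(2,3),\dots$ and then to the pairs $(1,2),(3,4),\dots$. Let $\mathcal L(\theta)=\mathrm{Tr}\big(U(\theta)\rho\,U(\theta)^\dagger H\big)$, and let the parameters be independent and uniform on $[-\pi,\pi]$. The losses *exhibit a barren plateau* if there is $b>1$ such that $\mathrm{Var}_\theta[\partial_k\mathcal L]\in O(1/b^n)$ for all parameters $\theta_k$ (with a constant uniform in $k$). **Statement.** If $(H_n)$ is mixed and $d(n)\in O(\log n)$, then the loss does not suffer from barren plateaus, namely $$\mathrm{Var}_\theta[\mathcal L]\in\Omega\left(\frac{1}{\mathrm{poly}(n)}\right),$$ and the losses do not exhibit a barren plateau. -/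

import Mathlib

open Filter MeasureTheory ProbabilityTheory

noncomputable section

/-- Operators on `n` qubits, as matrices in the computational basis `|x⟩`, `x ∈ {0,1}^n`. -/
abbrev QOp (n : ℕ) : Type := Matrix (Fin n → Fin 2) (Fin n → Fin 2) ℂ

/-- The tensor product `A₀ ⊗ A₁ ⊗ ⋯ ⊗ A_{n-1}` of one-qubit operators. -/
def tensorOp {n : ℕ} (A : Fin n → Matrix (Fin 2) (Fin 2) ℂ) : QOp n :=
  Matrix.of fun x y => ∏ i, A i (x i) (y i)

/-- The Pauli matrices `σ₀ = I`, `σ₁ = X`, `σ₂ = Y`, `σ₃ = Z`. -/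
def pauli : Fin 4 → Matrix (Fin 2) (Fin 2) ℂ :=
  ![1, !![0, 1; 1, 0], !![0, -Complex.I; Complex.I, 0], !![1, 0; 0, -1]]

/-- The Pauli string `P_α = ⊗ᵢ σ_{αᵢ}`. -/
def pauliString {n : ℕ} (α : Fin n → Fin 4) : QOp n :=
  tensorOp fun i => pauli (α i)

/-- The locality `|α| = #{i : αᵢ ≠ 0}` of a Pauli string: its number of non-identity factors. -/
def pauliWeight {n : ℕ} (α : Fin n → Fin 4) : ℕ :=
  (Finset.univ.filter fun i => α i ≠ 0).card

/-- The rotation gate `R_Y(t) = exp(-i t Y / 2)`. -/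
def rotY (t : ℝ) : Matrix (Fin 2) (Fin 2) ℂ :=
  !![(Real.cos (t / 2) : ℂ), -(Real.sin (t / 2) : ℂ);
     (Real.sin (t / 2) : ℂ), (Real.cos (t / 2) : ℂ)]

/-- The rotation gate `R_Z(t) = exp(-i t Z / 2)`. -/
def rotZ (t : ℝ) : Matrix (Fin 2) (Fin 2) ℂ :=
  !![Complex.exp (-(Complex.I * (t / 2 : ℝ))), 0;
     0, Complex.exp (Complex.I * (t / 2 : ℝ))]

/-- The rotation layer `(R_Y, R_Z)`: first `R_Y(a i 0)`, then `R_Z(a i 1)`, on every qubit `i`. -/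
def rotLayer {n : ℕ} (a : Fin n → Fin 2 → ℝ) : QOp n :=
  (tensorOp fun i => rotZ (a i 1)) * tensorOp fun i => rotY (a i 0)

/-- The CNOT gate with control `c` and target `t`: `|y⟩ ↦ |y with y_t replaced by y_t ⊕ y_c⟩`. -/
def cnot {n : ℕ} (c t : Fin n) : QOp n :=
  Matrix.of fun x y => if x = Function.update y t (y t + y c) then 1 else 0

/-- The CNOT gate on the neighbouring pair `(i, i+1)`; the last qubit has no right neighbour. -/
def cnotNext {n : ℕ} (i : Fin n) : QOp n :=
  if h : i.val + 1 < n then cnot i ⟨i.val + 1, h⟩ else 1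

/-- The CNOT gates on all pairs `(i, i+1)` with `i ≡ r` modulo 2. They act on disjoint pairs of
qubits, so that their order is immaterial. -/
def cnotSublayer (n r : ℕ) : QOp n :=
  (((List.finRange n).filter fun i => i.val % 2 = r).map cnotNext).prod

/-- The pairwise entangling layer: CNOT gates on the pairs `(0,1), (2,3), …`, followed by CNOT
gates on the pairs `(1,2), (3,4), …`. -/
def pairwiseLayer (n : ℕ) : QOp n :=
  cnotSublayer n 1 * cnotSublayer n 0

/-- The indices of the parameters of an EfficientSU2 circuit on `n` qubits with `d` repetitions:
`(l, i, s)` is the `R_Y` (`s = 0`) or `R_Z` (`s = 1`) gate on qubit `i` in rotation layer `l`. -/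
abbrev SU2Param (n d : ℕ) : Type := Fin (d + 1) × Fin n × Fin 2

/-- The EfficientSU2 circuit `R_d E R_{d-1} E ⋯ R_1 E R_0`, where `R_l` are the rotation layers and
`E` is the pairwise entangling layer. The rightmost factor acts first. -/
def efficientSU2 (n : ℕ) : (d : ℕ) → (SU2Param n d → ℝ) → QOp n
  | 0, θ => rotLayer fun i s => θ (0, i, s)
  | d + 1, θ =>
      (rotLayer fun i s => θ (Fin.last (d + 1), i, s)) * pairwiseLayer n *
        efficientSU2 n d fun p => θ (p.1.castSucc, p.2)

/-- The two forms of the ansatz: the circuit ends in a rotation layer (`e = false`), or in an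
entangling layer, the final rotation layer being skipped (`e = true`). -/
def efficientSU2Circuit (n d : ℕ) (e : Bool) (θ : SU2Param n d → ℝ) : QOp n :=
  if e then pairwiseLayer n * efficientSU2 n d θ else efficientSU2 n d θ

/-- The zero initial state `|0⟩⟨0|^{⊗n}`. -/
def zeroState (n : ℕ) : QOp n := Matrix.single 0 0 1

/-- The loss `𝓛(θ) = Tr(U(θ) ρ U(θ)† H)`, which is real for Hermitian `ρ` and `H`. -/
def vqaLoss {n : ℕ} {ι : Type} (U : (ι → ℝ) → QOp n) (ρ H : QOp n) (θ : ι → ℝ) : ℝ :=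
  (Matrix.trace (U θ * ρ * (U θ).conjTranspose * H)).re

/-- The law of independent parameters, each of them uniform on `[-π, π]`. -/
def uniformParams (ι : Type) [Fintype ι] : Measure (ι → ℝ) :=
  Measure.pi fun _ => cond (volume : Measure ℝ) (Set.Icc (-Real.pi) Real.pi)

/-- The partial derivative `∂_k L` at `θ`. -/
def partialDeriv {ι : Type} [DecidableEq ι] (k : ι) (L : (ι → ℝ) → ℝ) (θ : ι → ℝ) : ℝ :=
  deriv (fun t => L (Function.update θ k t)) (θ k)

/-- `f ∈ Ω(1 / poly n)`: `|f n| ≥ C / n ^ p` for some `p` and `C > 0` and all large `n`. -/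
def IsOmegaInvPoly (f : ℕ → ℝ) : Prop :=
  ∃ p : ℕ, (fun n : ℕ => 1 / (n : ℝ) ^ p) =O[atTop] f

/-- A family of observables is mixed if its expansion `H = ∑_α c_α P_α` with real coefficients
contains a non-identity Pauli term which is `O(1)`-local and has a coefficient in `Ω(1 / poly n)`.
-/
def IsMixed (H : (n : ℕ) → QOp n) : Prop :=
  ∃ c : (n : ℕ) → (Fin n → Fin 4) → ℝ,
    (∀ n, H n = ∑ α, (c n α : ℂ) • pauliString α) ∧
    ∃ (k : ℕ) (α : (n : ℕ) → Fin n → Fin 4),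
      (∀ᶠ n in atTop, 1 ≤ pauliWeight (α n) ∧ pauliWeight (α n) ≤ k) ∧
      IsOmegaInvPoly fun n => c n (α n)

/-- A family of losses exhibits a barren plateau if the variances of all its partial derivatives,
for uniform parameters, are in `O(1 / b ^ n)` for some `b > 1`. -/
def HasBarrenPlateau {ι : ℕ → Type} [∀ n, Fintype (ι n)] [∀ n, DecidableEq (ι n)]
    (L : (n : ℕ) → (ι n → ℝ) → ℝ) : Prop :=
  ∃ b : ℝ, 1 < b ∧ ∃ C : ℝ, ∀ᶠ n in atTop, ∀ k : ι n,
    variance (partialDeriv k (L n)) (uniformParams (ι n)) ≤ C / b ^ n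

end

noncomputable section

/-! The argument is a second-moment computation in the Heisenberg picture. Conjugation by `R_Z R_Y`
sends a Pauli matrix to a combination of Pauli matrices whose coefficients are products of a
trigonometric polynomial in each angle. For uniform angles, distinct entries of this Bloch matrix
are orthogonal in L² (`IsMixing`). The CNOT layers permute Pauli strings up to sign. Hence the
second moments of Pauli expectation values evolve by a Markov chain on strings, with no cross terms
(`integral_layerExp_mul`, `prod_blochMoment_eq_zero`).

All transition weights are nonnegative, so one path through the circuit bounds the second moment
below. A non-identity factor moves to X or to Z with weight at least 1/4, and I stays I with weight
1. Choosing X on even and Z on odd qubits makes the sublayer (1,2), (3,4), … act trivially, so the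
path never leaves a union S of pairs (0,1), (2,3), … (`exists_le_integral_preCircuit_sq`). In front
of the initial state the path ends in a string of I and Z, of expectation 1. The cost is 4^(-|S|)
per rotation layer, with |S| ≤ 4k.

Expectations of distinct strings are uncorrelated and non-identity strings are centred, so the other
Pauli terms can only add variance (`le_variance_sum_of_orthogonal`). Differentiating in an `R_Y`
angle of the last rotation layer, on a qubit of the support, preserves all these moment properties
(`isMixing_blochYDeriv`), so the same bound holds for that partial derivative. The bound c_α²
4^(-4k(d+1)) is inverse polynomial when d = O(log n). -/

/-! ### Rotation layers acting on Pauli strings. -/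

lemma tensorOp_mul {n : ℕ} (A B : Fin n → Matrix (Fin 2) (Fin 2) ℂ) :
    tensorOp A * tensorOp B = tensorOp fun i => A i * B i := by
  ext x y
  simp only [tensorOp, Matrix.mul_apply, Matrix.of_apply, ← Finset.prod_mul_distrib]
  rw [Finset.prod_univ_sum, Fintype.piFinset_univ]

lemma tensorOp_conjTranspose {n : ℕ} (A : Fin n → Matrix (Fin 2) (Fin 2) ℂ) :
    (tensorOp A).conjTranspose = tensorOp fun i => (A i).conjTranspose := by
  ext x y
  simp [tensorOp, Matrix.conjTranspose_apply]

lemma tensorOp_sum_smul {n : ℕ} (m : Fin n → Fin 4 → ℂ) (B : Fin 4 → Matrix (Fin 2) (Fin 2) ℂ) :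
    tensorOp (fun i => ∑ b, m i b • B b) =
      ∑ β : Fin n → Fin 4, (∏ i, m i (β i)) • tensorOp fun i => B (β i) := by
  ext x y
  simp only [tensorOp, Matrix.sum_apply, Matrix.of_apply, Matrix.smul_apply, smul_eq_mul,
    ← Finset.prod_mul_distrib]
  rw [Finset.prod_univ_sum, Fintype.piFinset_univ]

/-- The trigonometric polynomial `v₀ + v₁ cos t + v₂ sin t`. -/
def trig (v : Fin 3 → ℤ) (t : ℝ) : ℝ := v 0 + v 1 * Real.cos t + v 2 * Real.sin t

/-- The factor in the angle of `R_Y` of the Bloch matrix of `R_Z R_Y`. -/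
def blochY : Fin 4 → Fin 4 → Fin 3 → ℤ :=
  ![![![1, 0, 0], ![0, 0, 0], ![0, 0, 0], ![0, 0, 0]],
    ![![0, 0, 0], ![0, 1, 0], ![0, 1, 0], ![0, 0, -1]],
    ![![0, 0, 0], ![1, 0, 0], ![1, 0, 0], ![0, 0, 0]],
    ![![0, 0, 0], ![0, 0, 1], ![0, 0, 1], ![0, 1, 0]]]

/-- The factor in the angle of `R_Z` of the Bloch matrix of `R_Z R_Y`. -/
def blochZ : Fin 4 → Fin 4 → Fin 3 → ℤ :=
  ![![![1, 0, 0], ![0, 0, 0], ![0, 0, 0], ![0, 0, 0]],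
    ![![0, 0, 0], ![0, 1, 0], ![0, 0, 1], ![1, 0, 0]],
    ![![0, 0, 0], ![0, 0, -1], ![0, 1, 0], ![0, 0, 0]],
    ![![0, 0, 0], ![0, 1, 0], ![0, 0, 1], ![1, 0, 0]]]

lemma rotZ_conjTranspose (t : ℝ) : (rotZ t).conjTranspose =
    !![Complex.exp (Complex.I * (t / 2 : ℝ)), 0; 0, Complex.exp (-(Complex.I * (t / 2 : ℝ)))] := by
  have h : ∀ z : ℂ, starRingEnd ℂ (Complex.exp z) = Complex.exp (starRingEnd ℂ z) := fun z =>
    (Complex.exp_conj z).symm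
  ext i j
  fin_cases i <;> fin_cases j <;>
    simp [rotZ, Matrix.conjTranspose_apply, h, map_mul, Complex.conj_ofReal, -Complex.ofReal_div]

lemma exp_half_mul_self (t : ℝ) :
    Complex.exp (Complex.I * (t / 2 : ℝ)) * Complex.exp (Complex.I * (t / 2 : ℝ)) =
      Real.cos t + Real.sin t * Complex.I := by
  rw [← Complex.exp_add, Complex.ofReal_cos, Complex.ofReal_sin, ← Complex.exp_mul_I]
  congr 1; push_cast; ring

lemma exp_neg_half_mul_self (t : ℝ) :
    Complex.exp (-(Complex.I * (t / 2 : ℝ))) * Complex.exp (-(Complex.I * (t / 2 : ℝ))) =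
      Real.cos t - Real.sin t * Complex.I := by
  have := Complex.exp_mul_I (-(t : ℂ))
  rw [Complex.cos_neg, Complex.sin_neg, neg_mul (Complex.sin _), ← sub_eq_add_neg] at this
  rw [← Complex.exp_add, Complex.ofReal_cos, Complex.ofReal_sin, ← this]
  congr 1; push_cast; ring

lemma exp_half_mul_neg (t : ℝ) :
    Complex.exp (Complex.I * (t / 2 : ℝ)) * Complex.exp (-(Complex.I * (t / 2 : ℝ))) = 1 := by
  rw [← Complex.exp_add, add_neg_cancel, Complex.exp_zero]

lemma rotZ_conj (t : ℝ) :
    (rotZ t).conjTranspose * rotZ t = 1 ∧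
    (rotZ t).conjTranspose * pauli 1 * rotZ t =
      (Real.cos t : ℂ) • pauli 1 - (Real.sin t : ℂ) • pauli 2 ∧
    (rotZ t).conjTranspose * pauli 2 * rotZ t =
      (Real.cos t : ℂ) • pauli 2 + (Real.sin t : ℂ) • pauli 1 ∧
    (rotZ t).conjTranspose * pauli 3 * rotZ t = pauli 3 := by
  have h1 := exp_half_mul_self t
  have h2 := exp_neg_half_mul_self t
  have h3 := exp_half_mul_neg t
  have hI := Complex.I_mul_I
  rw [rotZ_conjTranspose, rotZ]
  -- With the exponentials abstracted, `h1`, `h2`, `h3` are the polynomial relations between u, v,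
  -- c, s that the entrywise identities need.
  generalize Complex.exp (Complex.I * (t / 2 : ℝ)) = u at *
  generalize Complex.exp (-(Complex.I * (t / 2 : ℝ))) = v at *
  generalize (Real.cos t : ℂ) = c at *
  generalize (Real.sin t : ℂ) = s at *
  refine ⟨?_, ?_, ?_, ?_⟩ <;> ext i j <;> fin_cases i <;> fin_cases j <;>
    simp [pauli, Matrix.mul_apply, Fin.sum_univ_two] <;> grind

lemma rotY_conjTranspose (t : ℝ) : (rotY t).conjTranspose =
    !![(Real.cos (t / 2) : ℂ), (Real.sin (t / 2) : ℂ);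
     -(Real.sin (t / 2) : ℂ), (Real.cos (t / 2) : ℂ)] := by
  ext i j
  fin_cases i <;> fin_cases j <;>
    simp [rotY, Matrix.conjTranspose_apply, Complex.conj_ofReal, -Complex.ofReal_cos,
      -Complex.ofReal_sin]

lemma rotY_conj (t : ℝ) :
    (rotY t).conjTranspose * rotY t = 1 ∧
    (rotY t).conjTranspose * pauli 1 * rotY t =
      (Real.cos t : ℂ) • pauli 1 + (Real.sin t : ℂ) • pauli 3 ∧
    (rotY t).conjTranspose * pauli 2 * rotY t = pauli 2 ∧
    (rotY t).conjTranspose * pauli 3 * rotY t =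
      (Real.cos t : ℂ) • pauli 3 - (Real.sin t : ℂ) • pauli 1 := by
  have hc : (Real.cos t : ℂ) = Real.cos (t / 2) ^ 2 - Real.sin (t / 2) ^ 2 := by
    exact_mod_cast (by rw [← Real.cos_two_mul', mul_div_cancel₀ t two_ne_zero] :
      Real.cos t = Real.cos (t / 2) ^ 2 - Real.sin (t / 2) ^ 2)
  have hs : (Real.sin t : ℂ) = 2 * Real.sin (t / 2) * Real.cos (t / 2) := by
    exact_mod_cast (by rw [← Real.sin_two_mul, mul_div_cancel₀ t two_ne_zero] :
      Real.sin t = 2 * Real.sin (t / 2) * Real.cos (t / 2))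
  have h1 : (Real.cos (t / 2) : ℂ) ^ 2 + (Real.sin (t / 2) : ℂ) ^ 2 = 1 := by
    exact_mod_cast Real.cos_sq_add_sin_sq (t / 2)
  rw [rotY_conjTranspose, rotY, hc, hs]
  generalize (Real.cos (t / 2) : ℂ) = c at *
  generalize (Real.sin (t / 2) : ℂ) = s at *
  refine ⟨?_, ?_, ?_, ?_⟩ <;> ext i j <;> fin_cases i <;> fin_cases j <;>
    simp [pauli, Matrix.mul_apply, Fin.sum_univ_two] <;> grind

lemma pauli_zero : pauli 0 = 1 := rfl

lemma rot_conj_pauli (s t : ℝ) (a : Fin 4) :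
    (rotZ t * rotY s).conjTranspose * pauli a * (rotZ t * rotY s) =
      ∑ b, ((trig (blochY b a) s * trig (blochZ b a) t : ℝ) : ℂ) • pauli b := by
  have h : (rotZ t * rotY s).conjTranspose * pauli a * (rotZ t * rotY s) =
      (rotY s).conjTranspose * ((rotZ t).conjTranspose * pauli a * rotZ t) * rotY s := by
    rw [Matrix.conjTranspose_mul]; simp only [Matrix.mul_assoc]
  obtain ⟨z0, z1, z2, z3⟩ := rotZ_conj t
  obtain ⟨y0, y1, y2, y3⟩ := rotY_conj s
  rw [h, Fin.sum_univ_four]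
  have ha : a = 0 ∨ a = 1 ∨ a = 2 ∨ a = 3 := by fin_cases a <;> simp
  rcases ha with rfl | rfl | rfl | rfl
  · rw [pauli_zero, mul_one, z0, mul_one, y0]
    simp [trig, blochY, blochZ]
  · rw [z1, mul_sub, sub_mul, Matrix.mul_smul, Matrix.smul_mul, Matrix.mul_smul,
      Matrix.smul_mul, y1, y2]
    simp [trig, blochY, blochZ, smul_add, smul_smul, mul_comm]
    abel
  · rw [z2, mul_add, add_mul, Matrix.mul_smul, Matrix.smul_mul, Matrix.mul_smul,
      Matrix.smul_mul, y1, y2]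
    simp [trig, blochY, blochZ, smul_add, smul_smul, mul_comm]
    abel
  · rw [z3, y3]
    simp [trig, blochY, blochZ]
    abel

/-- The Pauli transfer matrix of a rotation layer, for given factors in the angles of `R_Y`. -/
def layerMatrix {n : ℕ} (y : Fin n → Fin 4 → Fin 4 → Fin 3 → ℤ) (a : Fin n → Fin 2 → ℝ)
    (β α : Fin n → Fin 4) : ℝ :=
  ∏ j, trig (y j (β j) (α j)) (a j 0) * trig (blochZ (β j) (α j)) (a j 1)

lemma rotLayer_conj_pauliString {n : ℕ} (a : Fin n → Fin 2 → ℝ) (α : Fin n → Fin 4) :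
    (rotLayer a).conjTranspose * pauliString α * rotLayer a =
      ∑ β, (layerMatrix (fun _ => blochY) a β α : ℂ) • pauliString β := by
  rw [rotLayer, tensorOp_mul, tensorOp_conjTranspose, pauliString, tensorOp_mul, tensorOp_mul]
  simp only [rot_conj_pauli, layerMatrix, Complex.ofReal_prod]
  exact tensorOp_sum_smul _ pauli

/-! ### Entangling layers permute Pauli strings up to sign. -/

/-- The action of CNOT on the control of a pair of Pauli matrices. -/
def cnotControl (a b : Fin 4) : Fin 4 := if b = 2 ∨ b = 3 then ![3, 2, 1, 0] a else a

/-- The action of CNOT on the target of a pair of Pauli matrices. -/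
def cnotTarget (a b : Fin 4) : Fin 4 := if a = 1 ∨ a = 2 then ![1, 0, 3, 2] b else b

/-- The sign picked up by a pair of Pauli matrices under CNOT. -/
def cnotSign (a b : Fin 4) : ℝ := if (a = 1 ∧ b = 3) ∨ (a = 2 ∧ b = 2) then -1 else 1

lemma cnotSign_sq (a b : Fin 4) : cnotSign a b ^ 2 = 1 := by
  unfold cnotSign; split_ifs <;> norm_num

set_option maxHeartbeats 2000000 in
lemma pauli_cnot (a b : Fin 4) (x y u v : Fin 2) :
    pauli a x y * pauli b (u + x) (v + y) =
      cnotSign a b * (pauli (cnotControl a b) x y * pauli (cnotTarget a b) u v) := by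
  fin_cases a <;> fin_cases b <;> simp [cnotSign, cnotControl, cnotTarget, pauli] <;>
    fin_cases x <;> fin_cases y <;> fin_cases u <;> fin_cases v <;> simp [Matrix.one_apply]

/-- The action of the CNOT gate on Pauli strings, up to sign. -/
def cnotPauli {n : ℕ} (c t : Fin n) (α : Fin n → Fin 4) : Fin n → Fin 4 :=
  Function.update (Function.update α c (cnotControl (α c) (α t))) t (cnotTarget (α c) (α t))

/-- CNOT permutes the computational basis, so conjugation by it only relabels matrix entries; this
reduces its action on strings to the two-qubit table `pauli_cnot`. -/
lemma cnot_conj_apply {n : ℕ} (c t : Fin n) (A : QOp n) (x y : Fin n → Fin 2) :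
    ((cnot c t).conjTranspose * A * cnot c t) x y =
      A (Function.update x t (x t + x c)) (Function.update y t (y t + y c)) := by
  simp [Matrix.mul_apply, cnot, Matrix.conjTranspose_apply, apply_ite]

lemma cnot_conj_pauliString {n : ℕ} {c t : Fin n} (h : c ≠ t) (α : Fin n → Fin 4) :
    (cnot c t).conjTranspose * pauliString α * cnot c t =
      (cnotSign (α c) (α t) : ℂ) • pauliString (cnotPauli c t α) := by
  ext x y
  rw [cnot_conj_apply]
  have key : ∀ f : Fin n → ℂ, ∏ i, f i =
      f c * f t * ∏ i ∈ (Finset.univ.erase c).erase t, f i := fun f => by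
    rw [mul_assoc, Finset.mul_prod_erase _ _ (by simp [h.symm]), Finset.mul_prod_erase _ _ (by simp)]
  simp only [pauliString, tensorOp, Matrix.smul_apply, Matrix.of_apply, smul_eq_mul]
  rw [key, key (fun i => pauli (cnotPauli c t α i) (x i) (y i)), ← mul_assoc]
  congr 1
  · simpa [cnotPauli, Function.update_of_ne h] using pauli_cnot (α c) (α t) (x c) (y c) (x t) (y t)
  · refine Finset.prod_congr rfl fun i hi => ?_
    simp only [Finset.mem_erase, Finset.mem_univ, and_true] at hi
    simp [cnotPauli, Function.update_of_ne hi.1, Function.update_of_ne hi.2]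

/-- The action of `cnotNext` on Pauli strings, up to sign. -/
def nextPauli {n : ℕ} (i : Fin n) (α : Fin n → Fin 4) : Fin n → Fin 4 :=
  if h : i.val + 1 < n then cnotPauli i ⟨i.val + 1, h⟩ α else α

lemma cnotNext_conj_pauliString {n : ℕ} (i : Fin n) (α : Fin n → Fin 4) :
    ∃ s : ℝ, s ^ 2 = 1 ∧ (cnotNext i).conjTranspose * pauliString α * cnotNext i =
      (s : ℂ) • pauliString (nextPauli i α) := by
  unfold cnotNext nextPauli
  split_ifs with h
  · exact ⟨_, cnotSign_sq _ _, cnot_conj_pauliString (by simp [Fin.ext_iff]) α⟩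
  · exact ⟨1, by norm_num, by simp⟩

lemma cnotNext_list_conj_pauliString {n : ℕ} (l : List (Fin n)) (α : Fin n → Fin 4) :
    ∃ s : ℝ, s ^ 2 = 1 ∧
      (l.map cnotNext).prod.conjTranspose * pauliString α * (l.map cnotNext).prod =
        (s : ℂ) • pauliString (l.foldl (fun α i => nextPauli i α) α) := by
  induction l generalizing α with
  | nil => exact ⟨1, by norm_num, by simp⟩
  | cons i l ih =>
    obtain ⟨s, hs, h⟩ := cnotNext_conj_pauliString i α
    obtain ⟨s', hs', h'⟩ := ih (nextPauli i α)
    refine ⟨s * s', by rw [mul_pow, hs, hs', one_mul], ?_⟩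
    rw [List.map_cons, List.prod_cons, Matrix.conjTranspose_mul, List.foldl_cons]
    calc _ = (l.map cnotNext).prod.conjTranspose *
          ((cnotNext i).conjTranspose * pauliString α * cnotNext i) * (l.map cnotNext).prod := by
          simp only [Matrix.mul_assoc]
      _ = _ := by
          rw [h, Matrix.mul_smul, Matrix.smul_mul, h', smul_smul]; push_cast; rfl

/-- The action of an entangling sublayer on Pauli strings, up to sign. -/
def sublayerPauli {n : ℕ} (r : ℕ) (α : Fin n → Fin 4) : Fin n → Fin 4 :=
  ((List.finRange n).filter fun i => i.val % 2 = r).foldl (fun α i => nextPauli i α) α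

/-- The action of the pairwise entangling layer on Pauli strings, up to sign. -/
def pairwisePauli {n : ℕ} (α : Fin n → Fin 4) : Fin n → Fin 4 :=
  sublayerPauli 0 (sublayerPauli 1 α)

lemma cnotSublayer_conj_pauliString {n : ℕ} (r : ℕ) (α : Fin n → Fin 4) :
    ∃ s : ℝ, s ^ 2 = 1 ∧
      (cnotSublayer n r).conjTranspose * pauliString α * cnotSublayer n r =
        (s : ℂ) • pauliString (sublayerPauli r α) :=
  cnotNext_list_conj_pauliString _ α

lemma pairwiseLayer_conj_pauliString {n : ℕ} (α : Fin n → Fin 4) :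
    ∃ s : ℝ, s ^ 2 = 1 ∧
      (pairwiseLayer n).conjTranspose * pauliString α * pairwiseLayer n =
        (s : ℂ) • pauliString (pairwisePauli α) := by
  obtain ⟨s, hs, h⟩ := cnotSublayer_conj_pauliString 1 α
  obtain ⟨s', hs', h'⟩ := cnotSublayer_conj_pauliString 0 (sublayerPauli 1 α)
  refine ⟨s * s', by rw [mul_pow, hs, hs', one_mul], ?_⟩
  calc _ = (cnotSublayer n 0).conjTranspose *
        ((cnotSublayer n 1).conjTranspose * pauliString α * cnotSublayer n 1) *
          cnotSublayer n 0 := by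
        rw [pairwiseLayer, Matrix.conjTranspose_mul]; simp only [Matrix.mul_assoc]
    _ = _ := by
        rw [h, Matrix.mul_smul, Matrix.smul_mul, h', smul_smul]; push_cast; rfl

lemma cnot_pair_involutive : ∀ a b : Fin 4,
    cnotControl (cnotControl a b) (cnotTarget a b) = a ∧
      cnotTarget (cnotControl a b) (cnotTarget a b) = b := by
  decide

lemma nextPauli_involutive {n : ℕ} (i : Fin n) : Function.Involutive (nextPauli i) := by
  intro α
  unfold nextPauli
  split_ifs with h
  · have hne : i ≠ ⟨i.val + 1, h⟩ := by simp [Fin.ext_iff]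
    generalize (⟨i.val + 1, h⟩ : Fin n) = t at hne
    have hp := cnot_pair_involutive (α i) (α t)
    funext j
    by_cases hj : j = t
    · subst hj; simp [cnotPauli, Function.update_of_ne hne, hp]
    · by_cases hi : j = i
      · subst hi; simp [cnotPauli, Function.update_of_ne hne, hp]
      · simp [cnotPauli, hj, hi]
  · rfl

lemma foldl_nextPauli_injective {n : ℕ} (l : List (Fin n)) :
    Function.Injective fun α => l.foldl (fun α i => nextPauli i α) α := by
  induction l with
  | nil => exact fun _ _ h => h
  | cons i l ih => exact ih.comp (nextPauli_involutive i).injective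

lemma pairwisePauli_injective {n : ℕ} :
    Function.Injective (pairwisePauli : (Fin n → Fin 4) → Fin n → Fin 4) :=
  (foldl_nextPauli_injective _).comp (foldl_nextPauli_injective _)

/-! ### Supports of Pauli strings under entangling layers. -/

lemma foldl_invariant {σ ι : Type*} (p : σ → Prop) (g : σ → ι → σ) (l : List ι)
    (hg : ∀ s, p s → ∀ i ∈ l, p (g s i)) (s : σ) (hs : p s) : p (l.foldl g s) := by
  induction l generalizing s with
  | nil => exact hs
  | cons i l ih =>
    exact ih (fun s hs j hj => hg s hs j (List.mem_cons_of_mem _ hj)) _ (hg s hs i (by simp))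

/-- A set of qubits that is a union of blocks of qubits paired by an entangling sublayer. -/
def IsBlockClosed {n : ℕ} (r : ℕ) (S : Finset (Fin n)) : Prop :=
  ∀ (i : Fin n) (h : i.val + 1 < n), i.val % 2 = r → (i ∈ S ↔ (⟨i.val + 1, h⟩ : Fin n) ∈ S)

/-- Each CNOT changes only one pair of the sublayer and fixes I ⊗ I, so the support cannot leave a
union of pairs. -/
lemma sublayerPauli_support {n r : ℕ} {S : Finset (Fin n)} (hS : IsBlockClosed r S)
    {α : Fin n → Fin 4} (hα : ∀ i, α i ≠ 0 → i ∈ S) : ∀ i, sublayerPauli r α i ≠ 0 → i ∈ S := by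
  refine foldl_invariant (fun α : Fin n → Fin 4 => ∀ i, α i ≠ 0 → i ∈ S) _ _ ?_ α hα
  intro α hα i hi j hj
  simp only [List.mem_filter, List.mem_finRange, true_and, decide_eq_true_eq] at hi
  unfold nextPauli at hj
  split_ifs at hj with h
  · have hb := hS i h hi
    generalize (⟨i.val + 1, h⟩ : Fin n) = t at hb hj
    by_cases hz : α i = 0 ∧ α t = 0
    · refine hα j fun h0 => hj ?_
      unfold cnotPauli
      rw [hz.1, hz.2]
      by_cases hjt : j = t
      · subst hjt; simp [cnotTarget]
      · by_cases hji : j = i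
        · subst hji; simp [cnotControl, hjt]
        · simp [hjt, hji, h0]
    · have hiS : i ∈ S := by
        by_contra hn
        exact hz ⟨by_contra fun h => hn (hα _ h), by_contra fun h => hn (hb.2 (hα _ h))⟩
      by_cases hjt : j = t
      · exact hjt ▸ hb.1 hiS
      · by_cases hji : j = i
        · exact hji ▸ hiS
        · exact hα j (by simpa [cnotPauli, hjt, hji] using hj)
  · exact hα j hj

/-- The string with the support of `α` that has `X` on even and `Z` on odd qubits. -/
def alternatingPauli {n : ℕ} (α : Fin n → Fin 4) : Fin n → Fin 4 := fun j =>
  if α j = 0 then 0 else if j.val % 2 = 0 then 1 else 3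

/-- In this sublayer controls are odd and targets even. CNOT commutes with I or Z on its control and
with I or X on its target. -/
lemma sublayerPauli_one_alternatingPauli {n : ℕ} (α : Fin n → Fin 4) :
    sublayerPauli 1 (alternatingPauli α) = alternatingPauli α := by
  refine foldl_invariant (fun γ => γ = alternatingPauli α) _ _ ?_ _ rfl
  rintro _ rfl i hi
  simp only [List.mem_filter, List.mem_finRange, true_and, decide_eq_true_eq] at hi
  unfold nextPauli
  split_ifs with h
  · have h1 : alternatingPauli α i = 0 ∨ alternatingPauli α i = 3 := by
      unfold alternatingPauli; rw [hi]; split_ifs <;> simp_all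
    have h2 : alternatingPauli α ⟨i.val + 1, h⟩ = 0 ∨ alternatingPauli α ⟨i.val + 1, h⟩ = 1 := by
      have : (i.val + 1) % 2 = 0 := by omega
      unfold alternatingPauli; simp only [this]; split_ifs <;> simp_all
    have h3 : ∀ a b : Fin 4, (a = 0 ∨ a = 3) → (b = 0 ∨ b = 1) →
      cnotControl a b = a ∧ cnotTarget a b = b := by decide
    obtain ⟨h4, h5⟩ := h3 _ _ h1 h2
    rw [cnotPauli, h4, h5, Function.update_eq_self, Function.update_eq_self]
  · rfl

lemma pairwisePauli_alternatingPauli_support {n : ℕ} {S : Finset (Fin n)} (hS : IsBlockClosed 0 S)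
    {α : Fin n → Fin 4} (hα : ∀ i, α i ≠ 0 → i ∈ S) :
    ∀ i, pairwisePauli (alternatingPauli α) i ≠ 0 → i ∈ S := by
  rw [pairwisePauli, sublayerPauli_one_alternatingPauli]
  refine sublayerPauli_support hS fun i hi => hα i fun h => hi ?_
  simp [alternatingPauli, h]

lemma pairwisePauli_zero {n : ℕ} : pairwisePauli (0 : Fin n → Fin 4) = 0 := by
  have h0 : ∀ r, IsBlockClosed r (∅ : Finset (Fin n)) := fun r i h _ => by simp
  funext i
  by_contra h
  have := sublayerPauli_support (h0 0) (sublayerPauli_support (h0 1) (α := 0) (by simp)) i h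
  simp at this

lemma exists_isBlockClosed {n : ℕ} (r : ℕ) (S : Finset (Fin n)) :
    ∃ S' : Finset (Fin n), S ⊆ S' ∧ S'.card ≤ S.card * 2 ∧ IsBlockClosed r S' := by
  -- For r = 0, 1 the fibres of j ↦ (j + r) / 2 are exactly the blocks of the sublayer, each with at
  -- most two elements.
  refine ⟨S.biUnion fun i => Finset.univ.filter fun j => (j.val + r) / 2 = (i.val + r) / 2,
    fun i hi => by simpa using ⟨i, hi, rfl⟩, Finset.card_biUnion_le_card_mul _ _ _ fun i _ => ?_,
    fun i h hi => ?_⟩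
  · rw [← Finset.card_map Fin.valEmbedding]
    refine (Finset.card_le_card (t := {2 * ((i.val + r) / 2) - r,
      2 * ((i.val + r) / 2) + 1 - r}) fun m hm => ?_).trans Finset.card_le_two
    simp only [Finset.mem_map, Finset.mem_filter, Finset.mem_univ, true_and,
      Fin.valEmbedding_apply] at hm
    obtain ⟨j, hj, rfl⟩ := hm
    simp only [Finset.mem_insert, Finset.mem_singleton]
    omega
  · have : (i.val + 1 + r) / 2 = (i.val + r) / 2 := by omega
    simp [this]

/-- The set of qubits that the entangling layer can reach from the support of `α`. -/
lemma exists_support_isBlockClosed {n : ℕ} (α : Fin n → Fin 4) :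
    ∃ S : Finset (Fin n), S.card ≤ 4 * pauliWeight α ∧ IsBlockClosed 0 S ∧
      (∀ i, α i ≠ 0 → i ∈ S) ∧ ∀ i, pairwisePauli α i ≠ 0 → i ∈ S := by
  obtain ⟨S₁, h₁, hc₁, hb₁⟩ :=
    exists_isBlockClosed 1 (Finset.univ.filter fun i => α i ≠ 0)
  -- Closing under the pairs of sublayer 1, then of sublayer 0, follows the Heisenberg order; each
  -- closure at most doubles the size, whence the factor 4.
  obtain ⟨S₀, h₀, hc₀, hb₀⟩ := exists_isBlockClosed 0 S₁
  have hα : ∀ i, α i ≠ 0 → i ∈ S₁ := fun i hi => h₁ (by simpa using hi)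
  refine ⟨S₀, ?_, hb₀, fun i hi => h₀ (hα i hi), ?_⟩
  · unfold pauliWeight; omega
  · exact sublayerPauli_support hb₀ fun i hi => h₀ (sublayerPauli_support hb₁ hα i hi)

/-! ### Pauli expectation values and their continuity in the parameters. -/

/-- The expectation value of the Pauli string `P_α` in the state `V |0⟩`. -/
def pauliExp {n : ℕ} (V : QOp n) (α : Fin n → Fin 4) : ℝ :=
  (Matrix.trace (V * zeroState n * V.conjTranspose * pauliString α)).re

lemma trace_conj_mul {n : ℕ} (A V ρ P : QOp n) :
    Matrix.trace (A * V * ρ * (A * V).conjTranspose * P) =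
      Matrix.trace (V * ρ * V.conjTranspose * (A.conjTranspose * P * A)) := by
  rw [Matrix.conjTranspose_mul]
  calc _ = Matrix.trace (A * (V * ρ * V.conjTranspose * A.conjTranspose * P)) := by
        simp only [Matrix.mul_assoc]
    _ = _ := by rw [Matrix.trace_mul_comm]; simp only [Matrix.mul_assoc]

lemma pauliExp_rotLayer_mul {n : ℕ} (a : Fin n → Fin 2 → ℝ) (V : QOp n) (α : Fin n → Fin 4) :
    pauliExp (rotLayer a * V) α = ∑ β, pauliExp V β * layerMatrix (fun _ => blochY) a β α := by
  rw [pauliExp, trace_conj_mul, rotLayer_conj_pauliString, Matrix.mul_sum, Matrix.trace_sum,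
    Complex.re_sum]
  refine Finset.sum_congr rfl fun β _ => ?_
  rw [Matrix.mul_smul, Matrix.trace_smul, smul_eq_mul, Complex.re_ofReal_mul, mul_comm]
  rfl

lemma pauliExp_pairwiseLayer_mul {n : ℕ} (α : Fin n → Fin 4) : ∃ s : ℝ, s ^ 2 = 1 ∧
    ∀ V : QOp n, pauliExp (pairwiseLayer n * V) α = s * pauliExp V (pairwisePauli α) := by
  obtain ⟨s, hs, h⟩ := pairwiseLayer_conj_pauliString α
  refine ⟨s, hs, fun V => ?_⟩
  rw [pauliExp, trace_conj_mul, h, Matrix.mul_smul, Matrix.trace_smul, smul_eq_mul,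
    Complex.re_ofReal_mul]
  rfl

lemma pauliExp_one {n : ℕ} (α : Fin n → Fin 4) (hα : ∀ i, α i = 0 ∨ α i = 3) :
    pauliExp (1 : QOp n) α = 1 := by
  have h : pauliString α 0 0 = 1 := by
    simp only [pauliString, tensorOp, Matrix.of_apply]
    refine Finset.prod_eq_one fun i _ => ?_
    rcases hα i with h | h <;> simp [h, pauli]
  have : Matrix.trace (zeroState n * pauliString α) = pauliString α 0 0 := by
    simp [zeroState, Matrix.trace_single_mul]
  simp [pauliExp, this, h]

/-- The part of the circuit before its last rotation layer. -/
def preCircuit (n : ℕ) : (d : ℕ) → (Fin d × Fin n × Fin 2 → ℝ) → QOp n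
  | 0, _ => 1
  | d + 1, θ => pairwiseLayer n * efficientSU2 n d θ

lemma efficientSU2_eq (n d : ℕ) (θ : SU2Param n d → ℝ) :
    efficientSU2 n d θ = rotLayer (fun i s => θ (Fin.last d, i, s)) *
      preCircuit n d fun p => θ (p.1.castSucc, p.2) := by
  cases d with
  | zero => rw [preCircuit, mul_one]; rfl
  | succ d => rw [preCircuit, efficientSU2, Matrix.mul_assoc]

lemma continuous_tensorOp {n : ℕ} {X : Type*} [TopologicalSpace X]
    {A : X → Fin n → Matrix (Fin 2) (Fin 2) ℂ} (hA : ∀ i u v, Continuous fun x => A x i u v) :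
    Continuous fun x => tensorOp (A x) :=
  continuous_matrix fun u v => by
    simp only [tensorOp, Matrix.of_apply]
    exact continuous_finsetProd _ fun i _ => hA i (u i) (v i)

lemma continuous_rotLayer {n : ℕ} {X : Type*} [TopologicalSpace X] {a : X → Fin n → Fin 2 → ℝ}
    (ha : ∀ i s, Continuous fun x => a x i s) : Continuous fun x => rotLayer (a x) := by
  refine (continuous_tensorOp fun i u v => ?_).matrix_mul (continuous_tensorOp fun i u v => ?_)
  · have := ha i 1
    fin_cases u <;> fin_cases v <;> simp [rotZ] <;> fun_prop
  · have := ha i 0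
    fin_cases u <;> fin_cases v <;> simp [rotY] <;> fun_prop

lemma continuous_efficientSU2 (n d : ℕ) : Continuous (efficientSU2 n d) := by
  induction d with
  | zero => exact continuous_rotLayer fun i s => continuous_apply _
  | succ d ih =>
    exact ((continuous_rotLayer fun i s => continuous_apply _).matrix_mul
      continuous_const).matrix_mul (ih.comp (by fun_prop))

lemma continuous_pauliExp_preCircuit (n d : ℕ) (α : Fin n → Fin 4) :
    Continuous fun θ => pauliExp (preCircuit n d θ) α := by
  have h : Continuous (preCircuit n d) := by
    cases d with
    | zero => exact continuous_const
    | succ d => exact continuous_const.matrix_mul (continuous_efficientSU2 n d)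
  exact Complex.continuous_re.comp (((h.matrix_mul continuous_const).matrix_mul
    h.matrix_conjTranspose).matrix_mul continuous_const).matrix_trace

/-! ### Integration over uniform angles. -/

/-- The uniform law on `[-π, π]`. -/
abbrev uniformAngle : Measure ℝ := cond (volume : Measure ℝ) (Set.Icc (-Real.pi) Real.pi)

lemma volume_angles : (volume : Measure ℝ) (Set.Icc (-Real.pi) Real.pi) =
    ENNReal.ofReal (2 * Real.pi) := by
  rw [Real.volume_Icc]; congr 1; ring

instance isProbabilityMeasure_uniformAngle : IsProbabilityMeasure uniformAngle :=
  cond_isProbabilityMeasure_of_finite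
    (by rw [volume_angles]; simpa using Real.pi_pos) (by rw [volume_angles]; exact ENNReal.ofReal_ne_top)

instance isProbabilityMeasure_uniformParams (ι : Type) [Fintype ι] :
    IsProbabilityMeasure (uniformParams ι) := by
  unfold uniformParams; infer_instance

lemma integral_uniformAngle (f : ℝ → ℝ) :
    ∫ t, f t ∂uniformAngle = (2 * Real.pi)⁻¹ * ∫ t in (-Real.pi)..Real.pi, f t := by
  rw [uniformAngle, ProbabilityTheory.cond, integral_smul_measure, volume_angles,
    ENNReal.toReal_inv, ENNReal.toReal_ofReal (by positivity),
    intervalIntegral.integral_of_le (by linarith [Real.pi_pos]), integral_Icc_eq_integral_Ioc,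
    smul_eq_mul]

lemma trig_mul_trig (v w : Fin 3 → ℤ) (t : ℝ) : trig v t * trig w t =
    v 0 * w 0 + (v 0 * w 1 + v 1 * w 0) * Real.cos t + (v 0 * w 2 + v 2 * w 0) * Real.sin t +
      (v 1 * w 2 + v 2 * w 1) * (Real.sin t * Real.cos t) + v 1 * w 1 * Real.cos t ^ 2 +
      v 2 * w 2 * Real.sin t ^ 2 := by
  unfold trig; ring

lemma integral_trig_mul_trig (v w : Fin 3 → ℤ) : ∫ t, trig v t * trig w t ∂uniformAngle =
    v 0 * w 0 + (v 1 * w 1 + v 2 * w 2) / 2 := by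
  rw [integral_uniformAngle]
  simp only [trig_mul_trig]
  have hI : ∀ f : ℝ → ℝ, Continuous f → IntervalIntegrable f volume (-Real.pi) Real.pi :=
    fun f hf => hf.intervalIntegrable _ _
  rw [intervalIntegral.integral_add (hI _ (by fun_prop)) (hI _ (by fun_prop)),
    intervalIntegral.integral_add (hI _ (by fun_prop)) (hI _ (by fun_prop)),
    intervalIntegral.integral_add (hI _ (by fun_prop)) (hI _ (by fun_prop)),
    intervalIntegral.integral_add (hI _ (by fun_prop)) (hI _ (by fun_prop)),
    intervalIntegral.integral_add (hI _ (by fun_prop)) (hI _ (by fun_prop))]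
  simp only [intervalIntegral.integral_const_mul, intervalIntegral.integral_const, integral_cos,
    integral_sin, integral_sin_sq, integral_cos_sq, integral_sin_mul_cos₁]
  simp
  field_simp
  ring

lemma integral_trig (v : Fin 3 → ℤ) : ∫ t, trig v t ∂uniformAngle = v 0 := by
  simpa [trig] using integral_trig_mul_trig v ![1, 0, 0]

lemma ae_mem_box (ι : Type) [Fintype ι] :
    ∀ᵐ θ ∂uniformParams ι, θ ∈ Set.pi Set.univ fun _ => Set.Icc (-Real.pi) Real.pi := by
  simp only [Set.mem_pi, Set.mem_univ, true_implies]
  refine ae_all_iff.2 fun i => ?_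
  exact Measure.tendsto_eval_ae_ae.eventually (ae_cond_mem measurableSet_Icc)

lemma exists_bound_uniformParams {ι : Type} [Fintype ι] {f : (ι → ℝ) → ℝ} (hf : Continuous f) :
    ∃ C, ∀ᵐ θ ∂uniformParams ι, ‖f θ‖ ≤ C := by
  obtain ⟨C, hC⟩ := (isCompact_univ_pi fun _ : ι =>
    isCompact_Icc (a := -Real.pi) (b := Real.pi)).exists_bound_of_continuousOn hf.continuousOn
  exact ⟨C, (ae_mem_box ι).mono hC⟩

lemma memLp_uniformParams {ι : Type} [Fintype ι] {f : (ι → ℝ) → ℝ} (hf : Continuous f) :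
    MemLp f 2 (uniformParams ι) := by
  obtain ⟨C, hC⟩ := exists_bound_uniformParams hf
  exact MemLp.of_bound hf.aestronglyMeasurable C hC

lemma integrable_uniformParams {ι : Type} [Fintype ι] {f : (ι → ℝ) → ℝ} (hf : Continuous f) :
    Integrable f (uniformParams ι) :=
  (memLp_uniformParams hf).integrable one_le_two

lemma integral_uniformParams_prod {ι : Type} [Fintype ι] (h : ι → ℝ → ℝ) :
    ∫ θ, ∏ i, h i (θ i) ∂uniformParams ι = ∏ i, ∫ t, h i t ∂uniformAngle :=
  integral_fintype_prod_eq_prod h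

/-- Functions of disjoint groups of parameters are independent. -/
lemma integral_uniformParams_mul {ι κ τ : Type} [Fintype ι] [Fintype κ] [Fintype τ]
    (e : κ ⊕ τ ≃ ι) (f : (κ → ℝ) → ℝ) (g : (τ → ℝ) → ℝ) :
    ∫ θ, f (fun k => θ (e (.inl k))) * g (fun t => θ (e (.inr t))) ∂uniformParams ι =
      (∫ θ, f θ ∂uniformParams κ) * ∫ θ, g θ ∂uniformParams τ := by
  have h₁ := measurePreserving_piCongrLeft (fun _ : ι => uniformAngle) e
  have h₂ := measurePreserving_sumPiEquivProdPi (fun _ : κ ⊕ τ => uniformAngle)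
  rw [← integral_prod_mul]
  change _ = ∫ z : (κ → ℝ) × (τ → ℝ), f z.1 * g z.2 ∂((Measure.pi fun _ : κ => uniformAngle).prod
    (Measure.pi fun _ : τ => uniformAngle))
  rw [← h₂.integral_comp' fun z : (κ → ℝ) × (τ → ℝ) => f z.1 * g z.2, uniformParams,
    ← h₁.integral_comp']
  refine integral_congr_ae (ae_of_all _ fun θ => ?_)
  simp only [MeasurableEquiv.coe_piCongrLeft, Equiv.piCongrLeft_apply_apply]
  rfl

/-! ### Second moments and the Markov chain on Pauli strings. -/

/-- Four times the mixed second moment of two entries of a one-qubit Bloch matrix. -/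
def blochMoment (y : Fin 4 → Fin 4 → Fin 3 → ℤ) (b a b' a' : Fin 4) : ℤ :=
  (2 * (y b a 0 * y b' a' 0) + (y b a 1 * y b' a' 1 + y b a 2 * y b' a' 2)) *
    (2 * (blochZ b a 0 * blochZ b' a' 0) +
      (blochZ b a 1 * blochZ b' a' 1 + blochZ b a 2 * blochZ b' a' 2))

/-- The derivative of `blochY` in the angle. -/
def blochYDeriv (b a : Fin 4) : Fin 3 → ℤ := ![0, blochY b a 2, -blochY b a 1]

/-- The properties of the second moments of a one-qubit Bloch matrix that make Pauli strings
evolve, on average, by a Markov chain with transitions to `X` and `Z`. -/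
structure IsMixing (y : Fin 4 → Fin 4 → Fin 3 → ℤ) : Prop where
  orthogonal : ∀ b a b' a', (a ≠ a' ∨ b ≠ b') → blochMoment y b a b' a' = 0
  nonneg : ∀ b a, 0 ≤ blochMoment y b a b a
  one_le : ∀ b a, a ≠ 0 → (b = 1 ∨ b = 3) → 1 ≤ blochMoment y b a b a
  mean : ∀ b a, a ≠ 0 → y b a 0 * blochZ b a 0 = 0

lemma isMixing_blochY : IsMixing blochY where
  orthogonal := by decide
  nonneg := by decide
  one_le := by decide
  mean := by decide

/-- Differentiation kills constants and exchanges cosine and sine up to sign. The entries used by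
the path, with target X or Z, have no constant term in the `R_Y` angle, so they keep their L² norm.
-/
lemma isMixing_blochYDeriv : IsMixing blochYDeriv where
  orthogonal := by decide
  nonneg := by decide
  one_le := by decide
  mean := by decide

lemma continuous_trig (v : Fin 3 → ℤ) : Continuous (trig v) := by
  unfold trig; fun_prop

lemma integral_layerMatrix {n : ℕ} (y : Fin n → Fin 4 → Fin 4 → Fin 3 → ℤ) (β α : Fin n → Fin 4) :
    ∫ θ, layerMatrix y (fun i s => θ (i, s)) β α ∂uniformParams (Fin n × Fin 2) =
      ∏ j, ((y j (β j) (α j) 0 * blochZ (β j) (α j) 0 : ℤ) : ℝ) := by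
  have h := integral_uniformParams_prod fun (p : Fin n × Fin 2) t =>
    trig ((![y p.1, blochZ] : Fin 2 → Fin 4 → Fin 4 → Fin 3 → ℤ) p.2 (β p.1) (α p.1)) t
  simp only [Fintype.prod_prod_type, Fin.prod_univ_two, Matrix.cons_val_zero, Matrix.cons_val_one,
    integral_trig] at h
  simpa [layerMatrix] using h

lemma integral_layerMatrix_mul {n : ℕ} (y : Fin n → Fin 4 → Fin 4 → Fin 3 → ℤ)
    (β α β' α' : Fin n → Fin 4) :
    ∫ θ, layerMatrix y (fun i s => θ (i, s)) β α * layerMatrix y (fun i s => θ (i, s)) β' α'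
        ∂uniformParams (Fin n × Fin 2) =
      ∏ j, (blochMoment (y j) (β j) (α j) (β' j) (α' j) : ℝ) / 4 := by
  have h := integral_uniformParams_prod fun (p : Fin n × Fin 2) t =>
    trig ((![y p.1, blochZ] : Fin 2 → Fin 4 → Fin 4 → Fin 3 → ℤ) p.2 (β p.1) (α p.1)) t *
    trig ((![y p.1, blochZ] : Fin 2 → Fin 4 → Fin 4 → Fin 3 → ℤ) p.2 (β' p.1) (α' p.1)) t
  simp only [Fintype.prod_prod_type, Fin.prod_univ_two, Matrix.cons_val_zero, Matrix.cons_val_one,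
    integral_trig_mul_trig] at h
  convert h using 2
  · simp only [layerMatrix, ← Finset.prod_mul_distrib]
    exact funext fun θ => Finset.prod_congr rfl fun j _ => by ring
  · simp only [blochMoment]; push_cast; ring

/-- The parameters of a circuit, split into those of the last rotation layer and the others. -/
def splitLastLayer (n d : ℕ) : (Fin d × Fin n × Fin 2) ⊕ (Fin n × Fin 2) ≃ SU2Param n d where
  toFun := Sum.elim (fun p => (p.1.castSucc, p.2)) fun p => (Fin.last d, p)
  invFun p := Fin.lastCases (motive := fun _ => (Fin d × Fin n × Fin 2) ⊕ (Fin n × Fin 2))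
    (.inr p.2) (fun l => .inl (l, p.2)) p.1
  left_inv := by rintro (p | p) <;> simp
  right_inv := by
    rintro ⟨l, p⟩
    induction l using Fin.lastCases <;> simp

/-- The expectation value of `P_α` after `preCircuit` and a layer with the Bloch factors `y`. -/
def layerExp {n d : ℕ} (y : Fin n → Fin 4 → Fin 4 → Fin 3 → ℤ) (α : Fin n → Fin 4)
    (θ : SU2Param n d → ℝ) : ℝ :=
  ∑ β, pauliExp (preCircuit n d fun p => θ (p.1.castSucc, p.2)) β *
    layerMatrix y (fun i s => θ (Fin.last d, i, s)) β α

lemma pauliExp_efficientSU2 {n d : ℕ} (θ : SU2Param n d → ℝ) (α : Fin n → Fin 4) :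
    pauliExp (efficientSU2 n d θ) α = layerExp (fun _ => blochY) α θ := by
  rw [efficientSU2_eq, pauliExp_rotLayer_mul]; rfl

lemma continuous_preCircuit_term {n d : ℕ} (β : Fin n → Fin 4) :
    Continuous fun θ : SU2Param n d → ℝ =>
      pauliExp (preCircuit n d fun p => θ (p.1.castSucc, p.2)) β :=
  (continuous_pauliExp_preCircuit n d β).comp
    (continuous_pi fun p => continuous_apply (p.1.castSucc, p.2))

lemma continuous_layerMatrix_last {n d : ℕ} (y : Fin n → Fin 4 → Fin 4 → Fin 3 → ℤ)
    (β α : Fin n → Fin 4) : Continuous fun θ : SU2Param n d → ℝ =>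
      layerMatrix y (fun i s => θ (Fin.last d, i, s)) β α := by
  unfold layerMatrix
  exact continuous_finsetProd _ fun j _ => ((continuous_trig _).comp (continuous_apply _)).mul
    ((continuous_trig _).comp (continuous_apply _))

lemma continuous_layerExp_term {n d : ℕ} (y : Fin n → Fin 4 → Fin 4 → Fin 3 → ℤ)
    (β α : Fin n → Fin 4) : Continuous fun θ : SU2Param n d → ℝ =>
      pauliExp (preCircuit n d fun p => θ (p.1.castSucc, p.2)) β *
        layerMatrix y (fun i s => θ (Fin.last d, i, s)) β α :=
  (continuous_preCircuit_term β).mul (continuous_layerMatrix_last y β α)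

lemma continuous_layerExp {n d : ℕ} (y : Fin n → Fin 4 → Fin 4 → Fin 3 → ℤ) (α : Fin n → Fin 4) :
    Continuous (layerExp (d := d) y α) :=
  continuous_finsetSum _ fun β _ => continuous_layerExp_term y β α

/-- The last layer is independent of the rest of the circuit, and at a non-identity position each of
its entries has mean zero. -/
lemma integral_layerExp {n d : ℕ} {y : Fin n → Fin 4 → Fin 4 → Fin 3 → ℤ}
    (hy : ∀ j, IsMixing (y j)) {α : Fin n → Fin 4} (hα : α ≠ 0) :
    ∫ θ, layerExp (d := d) y α θ ∂uniformParams (SU2Param n d) = 0 := by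
  obtain ⟨j, hj⟩ := Function.ne_iff.1 hα
  unfold layerExp
  rw [integral_finsetSum _ fun β _ => integrable_uniformParams
    (continuous_layerExp_term y β α)]
  refine Finset.sum_eq_zero fun β _ => ?_
  refine (integral_uniformParams_mul (splitLastLayer n d) (fun θ => pauliExp (preCircuit n d θ) β)
    fun θ => layerMatrix y (fun i s => θ (i, s)) β α).trans ?_
  rw [integral_layerMatrix, Finset.prod_eq_zero (Finset.mem_univ j), mul_zero]
  rw [(hy j).mean _ _ hj, Int.cast_zero]

lemma integral_layerExp_mul {n d : ℕ} (y : Fin n → Fin 4 → Fin 4 → Fin 3 → ℤ)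
    (α α' : Fin n → Fin 4) :
    ∫ θ, layerExp (d := d) y α θ * layerExp y α' θ ∂uniformParams (SU2Param n d) =
      ∑ β, ∑ β', (∫ θ, pauliExp (preCircuit n d θ) β * pauliExp (preCircuit n d θ) β'
        ∂uniformParams (Fin d × Fin n × Fin 2)) *
          ∏ j, (blochMoment (y j) (β j) (α j) (β' j) (α' j) : ℝ) / 4 := by
  have hc : ∀ β β', Continuous fun θ : SU2Param n d → ℝ =>
      (pauliExp (preCircuit n d fun p => θ (p.1.castSucc, p.2)) β *
        layerMatrix y (fun i s => θ (Fin.last d, i, s)) β α) *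
      (pauliExp (preCircuit n d fun p => θ (p.1.castSucc, p.2)) β' *
        layerMatrix y (fun i s => θ (Fin.last d, i, s)) β' α') := fun β β' =>

    (continuous_layerExp_term y β α).mul (continuous_layerExp_term y β' α')
  simp only [layerExp, Finset.sum_mul_sum]
  rw [integral_finsetSum _ fun β _ => integrable_uniformParams
    (continuous_finsetSum _ fun β' _ => hc β β')]
  refine Finset.sum_congr rfl fun β _ => ?_
  rw [integral_finsetSum _ fun β' _ => integrable_uniformParams (hc β β')]
  refine Finset.sum_congr rfl fun β' _ => ?_
  rw [← integral_layerMatrix_mul, ← integral_uniformParams_mul (splitLastLayer n d)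
    (fun θ => pauliExp (preCircuit n d θ) β * pauliExp (preCircuit n d θ) β')
    (fun θ => layerMatrix y (fun i s => θ (i, s)) β α * layerMatrix y (fun i s => θ (i, s)) β' α')]
  refine integral_congr_ae (ae_of_all _ fun θ => ?_)
  simp only [splitLastLayer, Equiv.coe_fn_mk, Sum.elim_inl, Sum.elim_inr]
  ring

lemma prod_blochMoment_eq_zero {n : ℕ} {y : Fin n → Fin 4 → Fin 4 → Fin 3 → ℤ}
    (hy : ∀ j, IsMixing (y j)) {β α β' α' : Fin n → Fin 4} (h : α ≠ α' ∨ β ≠ β') :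
    ∏ j, (blochMoment (y j) (β j) (α j) (β' j) (α' j) : ℝ) / 4 = 0 := by
  obtain ⟨j, hj⟩ : ∃ j, α j ≠ α' j ∨ β j ≠ β' j := by
    rcases h with h | h
    · exact (Function.ne_iff.1 h).imp fun _ => Or.inl
    · exact (Function.ne_iff.1 h).imp fun _ => Or.inr
  exact Finset.prod_eq_zero (Finset.mem_univ j) (by simp [(hy j).orthogonal _ _ _ _ hj])

lemma integral_layerExp_mul_of_ne {n d : ℕ} {y : Fin n → Fin 4 → Fin 4 → Fin 3 → ℤ}
    (hy : ∀ j, IsMixing (y j)) {α α' : Fin n → Fin 4} (h : α ≠ α') :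
    ∫ θ, layerExp (d := d) y α θ * layerExp y α' θ ∂uniformParams (SU2Param n d) = 0 := by
  rw [integral_layerExp_mul]
  exact Finset.sum_eq_zero fun β _ => Finset.sum_eq_zero fun β' _ => by
    rw [prod_blochMoment_eq_zero hy (Or.inl h), mul_zero]

/-- One transition α → β of the Markov chain: only the diagonal terms survive, they are nonnegative,
and all but the β term are dropped. -/
lemma le_integral_layerExp_sq {n d : ℕ} {y : Fin n → Fin 4 → Fin 4 → Fin 3 → ℤ}
    (hy : ∀ j, IsMixing (y j)) {S : Finset (Fin n)} {α β : Fin n → Fin 4}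
    (hαS : ∀ j, α j ≠ 0 → j ∈ S) (hα : ∀ j, α j ≠ 0 → β j = 1 ∨ β j = 3)
    (h0 : ∀ j, α j = 0 → β j = 0 ∧ y j = blochY) :
    (1 / 4 : ℝ) ^ S.card * ∫ θ, pauliExp (preCircuit n d θ) β ^ 2
        ∂uniformParams (Fin d × Fin n × Fin 2) ≤
      ∫ θ, layerExp (d := d) y α θ ^ 2 ∂uniformParams (SU2Param n d) := by
  have hnn : ∀ γ : Fin n → Fin 4, 0 ≤ ∫ θ, pauliExp (preCircuit n d θ) γ ^ 2
        ∂uniformParams (Fin d × Fin n × Fin 2) := fun γ => integral_nonneg fun θ => sq_nonneg _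
  have hprod : (1 / 4 : ℝ) ^ S.card ≤
      ∏ j, (blochMoment (y j) (β j) (α j) (β j) (α j) : ℝ) / 4 := by
    rw [← Finset.prod_const, ← Finset.prod_subset (Finset.subset_univ S)
      (f := fun j => (blochMoment (y j) (β j) (α j) (β j) (α j) : ℝ) / 4)]
    · refine Finset.prod_le_prod (fun _ _ => by norm_num) fun j _ => ?_
      have : 1 ≤ blochMoment (y j) (β j) (α j) (β j) (α j) := by
        by_cases h : α j = 0
        · rw [(h0 j h).1, (h0 j h).2, h]; decide
        · exact (hy j).one_le _ _ h (hα j h)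
      have : (1 : ℝ) ≤ blochMoment (y j) (β j) (α j) (β j) (α j) := by exact_mod_cast this
      linarith
    -- Off S both strings are the identity, where the transition weight is exactly 1; hence the
    -- bound depends on |S| and not on n.
    · intro j _ hj
      have h : α j = 0 := by_contra fun h => hj (hαS j h)
      rw [(h0 j h).1, (h0 j h).2, h]
      have : blochMoment blochY 0 0 0 0 = 4 := by decide
      rw [this]; norm_num
  simp only [sq (layerExp _ _ _), integral_layerExp_mul]
  have hdiag : ∀ γ : Fin n → Fin 4, ∑ γ', (∫ θ, pauliExp (preCircuit n d θ) γ *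
      pauliExp (preCircuit n d θ) γ' ∂uniformParams (Fin d × Fin n × Fin 2)) *
          ∏ j, (blochMoment (y j) (γ j) (α j) (γ' j) (α j) : ℝ) / 4 =
      (∫ θ, pauliExp (preCircuit n d θ) γ ^ 2 ∂uniformParams (Fin d × Fin n × Fin 2)) *
          ∏ j, (blochMoment (y j) (γ j) (α j) (γ j) (α j) : ℝ) / 4 := fun γ => by
    rw [Finset.sum_eq_single γ]
    · simp only [sq]
    · intro γ' _ h
      rw [prod_blochMoment_eq_zero hy (Or.inr h.symm), mul_zero]
    · simp
  rw [Finset.sum_congr rfl fun γ _ => hdiag γ, mul_comm]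
  refine (mul_le_mul_of_nonneg_left hprod (hnn β)).trans (Finset.single_le_sum
    (f := fun γ => (∫ θ, pauliExp (preCircuit n d θ) γ ^ 2
      ∂uniformParams (Fin d × Fin n × Fin 2)) *
        ∏ j, (blochMoment (y j) (γ j) (α j) (γ j) (α j) : ℝ) / 4) (fun γ _ => ?_)
    (Finset.mem_univ β))
  exact mul_nonneg (hnn γ) (Finset.prod_nonneg fun j _ =>
    div_nonneg (by exact_mod_cast (hy j).nonneg _ _) (by norm_num))

/-- A Pauli string supported in a block-closed set `S` can be followed through the whole circuit
without leaving `S`. -/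
lemma exists_le_integral_preCircuit_sq {n : ℕ} {S : Finset (Fin n)} (hS : IsBlockClosed 0 S) (d : ℕ)
    {α : Fin n → Fin 4} (hα : ∀ j, α j ≠ 0 → j ∈ S) :
    ∃ β : Fin n → Fin 4, (∀ j, α j ≠ 0 → β j = 1 ∨ β j = 3) ∧ (∀ j, α j = 0 → β j = 0) ∧
      (1 / 4 : ℝ) ^ (S.card * d) ≤ ∫ θ, pauliExp (preCircuit n d θ) β ^ 2
        ∂uniformParams (Fin d × Fin n × Fin 2) := by
  induction d generalizing α with
  | zero =>
    refine ⟨fun j => if α j = 0 then 0 else 3, fun j hj => by simp [hj], fun j hj => by simp [hj],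
      ?_⟩
    -- The path must end in Z rather than X on the support, for a nonzero expectation in the zero
    -- state.
    have : ∀ θ, pauliExp (preCircuit n 0 θ) (fun j => if α j = 0 then 0 else 3) = 1 := fun θ =>
      pauliExp_one _ fun j => by by_cases h : α j = 0 <;> simp [h]
    simp [this]
  | succ d ih =>
    refine ⟨alternatingPauli α, fun j hj => ?_, fun j hj => by simp [alternatingPauli, hj], ?_⟩
    · unfold alternatingPauli; rw [if_neg hj]; split_ifs <;> simp
    have hsupp := pairwisePauli_alternatingPauli_support hS hα
    obtain ⟨β, h1, h2, h3⟩ := ih hsupp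
    obtain ⟨s, hs, h⟩ := pauliExp_pairwiseLayer_mul (alternatingPauli α)
    have := le_integral_layerExp_sq (d := d) (y := fun _ => blochY) (fun _ => isMixing_blochY)
      hsupp h1 fun j hj => ⟨h2 j hj, rfl⟩
    simp only [preCircuit, h, mul_pow, hs, one_mul, pauliExp_efficientSU2]
    refine le_trans ?_ this
    rw [mul_add, mul_one, pow_add, mul_comm]
    exact mul_le_mul_of_nonneg_left h3 (by positivity)

/-! ### Variance bounds for combinations of Pauli expectations. -/

/-- The variance of a linear combination of orthogonal random variables, all but one of which are
centred, is bounded below by that of each centred term. -/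
lemma le_variance_sum_of_orthogonal {Ω A : Type*} [MeasurableSpace Ω] {μ : Measure Ω}
    [IsProbabilityMeasure μ] [Fintype A] {F : A → Ω → ℝ} (hF : ∀ a, MemLp (F a) 2 μ) (o : A)
    (horth : ∀ a b, a ≠ b → ∫ x, F a x * F b x ∂μ = 0) (hmean : ∀ a, a ≠ o → ∫ x, F a x ∂μ = 0)
    (w : A → ℝ) {a : A} (ha : a ≠ o) :
    w a ^ 2 * ∫ x, F a x ^ 2 ∂μ ≤ variance (fun x => ∑ b, w b * F b x) μ := by
  classical
  have hcov : ∀ b c, b ≠ c → covariance (F b) (F c) μ = 0 := fun b c hbc => by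
    rw [covariance_eq_sub (hF b) (hF c)]
    have h1 : ∫ x, (F b * F c) x ∂μ = 0 := horth b c hbc
    rw [h1]
    -- Of two distinct indices at most one is `o`, so the product of the means vanishes.
    rcases ne_or_eq b o with hb | rfl
    · rw [hmean b hb]; simp
    · rw [hmean c hbc.symm]; simp
  have hvar : variance (fun x => ∑ b, w b * F b x) μ = ∑ b, w b ^ 2 * variance (F b) μ := by
    have hm : ∀ b, MemLp (fun x => w b * F b x) 2 μ := fun b => (hF b).const_mul (w b)
    rw [variance_fun_sum hm]
    refine Finset.sum_congr rfl fun b _ => ?_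
    rw [Finset.sum_eq_single b]
    · rw [covariance_self (hm b).aemeasurable, variance_const_mul]
    · intro c _ hc
      rw [covariance_const_mul_left, covariance_const_mul_right, hcov b c hc.symm]; simp
    · simp
  rw [hvar]
  refine le_trans (le_of_eq ?_) (Finset.single_le_sum (f := fun b => w b ^ 2 * variance (F b) μ)
    (fun b _ => mul_nonneg (sq_nonneg _) (variance_nonneg _ _)) (Finset.mem_univ a))
  rw [variance_eq_sub (hF a), hmean a ha]
  simp

lemma le_variance_sum_layerExp {n d : ℕ} {y : Fin n → Fin 4 → Fin 4 → Fin 3 → ℤ}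
    (hy : ∀ j, IsMixing (y j)) {S : Finset (Fin n)} (hS : IsBlockClosed 0 S) {α : Fin n → Fin 4}
    (hαS : ∀ j, α j ≠ 0 → j ∈ S) (hα : α ≠ 0) (h0 : ∀ j, α j = 0 → y j = blochY)
    (w : (Fin n → Fin 4) → ℝ) :
    w α ^ 2 * (1 / 4 : ℝ) ^ (S.card * (d + 1)) ≤
      variance (fun θ => ∑ β, w β * layerExp (d := d) y β θ) (uniformParams (SU2Param n d)) := by
  obtain ⟨β, h1, h2, h3⟩ := exists_le_integral_preCircuit_sq hS d hαS
  refine le_trans ?_ (le_variance_sum_of_orthogonal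
    (fun γ => memLp_uniformParams (continuous_layerExp y γ)) 0
    (fun γ γ' h => integral_layerExp_mul_of_ne hy h) (fun γ hγ => integral_layerExp hy hγ) w hα)
  refine mul_le_mul_of_nonneg_left (le_trans ?_ (le_integral_layerExp_sq hy hαS h1
    fun j hj => ⟨h2 j hj, h0 j hj⟩)) (sq_nonneg _)
  rw [mul_add, mul_one, pow_add, mul_comm]
  exact mul_le_mul_of_nonneg_left h3 (by positivity)

/-! ### Derivatives in an `R_Y` angle of the last rotation layer. -/

lemma hasDerivAt_trig_blochY (b a : Fin 4) (t : ℝ) :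
    HasDerivAt (trig (blochY b a)) (trig (blochYDeriv b a) t) t := by
  have h := (((Real.hasDerivAt_cos t).const_mul (blochY b a 1 : ℝ)).const_add
    (blochY b a 0 : ℝ)).add ((Real.hasDerivAt_sin t).const_mul (blochY b a 2 : ℝ))
  refine h.congr_deriv ?_
  simp [trig, blochYDeriv]
  ring

lemma hasDerivAt_layerMatrix {n : ℕ} (i : Fin n) (a : Fin n → Fin 2 → ℝ)
    (a' : ℝ → Fin n → Fin 2 → ℝ) (ha0 : ∀ t, a' t i 0 = t) (ha1 : ∀ t, a' t i 1 = a i 1)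
    (ha : ∀ t j, j ≠ i → a' t j = a j) (β α : Fin n → Fin 4) :
    HasDerivAt (fun t => layerMatrix (fun _ => blochY) (a' t) β α)
      (layerMatrix (Function.update (fun _ => blochY) i blochYDeriv) a β α) (a i 0) := by
  have h := ((hasDerivAt_trig_blochY (β i) (α i) (a i 0)).mul_const
    (trig (blochZ (β i) (α i)) (a i 1))).mul_const (∏ j ∈ Finset.univ.erase i,
      trig (blochY (β j) (α j)) (a j 0) * trig (blochZ (β j) (α j)) (a j 1))
  refine (h.congr_deriv ?_).congr_of_eventuallyEq (.of_forall fun t => ?_)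
  · rw [layerMatrix, ← Finset.mul_prod_erase _ _ (Finset.mem_univ i), Function.update_self]
    congr 1
    refine Finset.prod_congr rfl fun j hj => ?_
    rw [Function.update_of_ne (Finset.ne_of_mem_erase hj)]
  · simp only [layerMatrix]
    rw [← Finset.mul_prod_erase _ _ (Finset.mem_univ i), ha0, ha1]
    congr 1
    refine Finset.prod_congr rfl fun j hj => ?_
    rw [ha t j (Finset.ne_of_mem_erase hj)]

lemma hasDerivAt_layerExp {n d : ℕ} (i : Fin n) (α : Fin n → Fin 4) (θ : SU2Param n d → ℝ) :
    HasDerivAt (fun t => layerExp (fun _ => blochY) α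
        (Function.update θ ((Fin.last d, i, 0) : SU2Param n d) t))
      (layerExp (Function.update (fun _ => blochY) i blochYDeriv) α θ)
      (θ (Fin.last d, i, 0)) := by
  have hne : ∀ (t : ℝ) (p : Fin d × Fin n × Fin 2),
      Function.update θ ((Fin.last d, i, 0) : SU2Param n d) t (p.1.castSucc, p.2) =
        θ (p.1.castSucc, p.2) := fun t p =>
    Function.update_of_ne (fun h => (Fin.castSucc_lt_last p.1).ne (congrArg Prod.fst h)) _ _
  unfold layerExp
  simp only [hne]
  refine HasDerivAt.fun_sum fun β _ => HasDerivAt.const_mul _ ?_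
  refine hasDerivAt_layerMatrix i (fun i s => θ (Fin.last d, i, s)) _ (fun t => ?_) (fun t => ?_)
    (fun t j hj => ?_) β α
  · simp
  · simp
  · funext s
    simp [hj]

/-- The derivative has the same form as the loss with one Bloch factor changed, so one variance
bound serves both. -/
lemma partialDeriv_sum_layerExp {n d : ℕ} (i : Fin n) (w : (Fin n → Fin 4) → ℝ) :
    partialDeriv ((Fin.last d, i, 0) : SU2Param n d)
        (fun θ => ∑ β, w β * layerExp (fun _ => blochY) β θ) =
      fun θ => ∑ β, w β * layerExp (Function.update (fun _ => blochY) i blochYDeriv) β θ :=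
  funext fun θ => (HasDerivAt.fun_sum fun β _ => (hasDerivAt_layerExp i β θ).const_mul (w β)).deriv

/-! ### The contribution of one Pauli term to the loss. -/

lemma vqaLoss_sum_pauliString {n : ℕ} {ι : Type} (U : (ι → ℝ) → QOp n)
    (c : (Fin n → Fin 4) → ℝ) (θ : ι → ℝ) :
    vqaLoss U (zeroState n) (∑ α, (c α : ℂ) • pauliString α) θ = ∑ α, c α * pauliExp (U θ) α := by
  rw [vqaLoss, Matrix.mul_sum, Matrix.trace_sum, Complex.re_sum]
  refine Finset.sum_congr rfl fun α _ => ?_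
  rw [Matrix.mul_smul, Matrix.trace_smul, smul_eq_mul, Complex.re_ofReal_mul]
  rfl

/-- The Pauli expansion of the loss in front of the last rotation layer, and the coefficient of a
given Pauli string in it. -/
lemma exists_vqaLoss_eq_sum_layerExp {n : ℕ} (d : ℕ) (e : Bool) (c : (Fin n → Fin 4) → ℝ)
    (α : Fin n → Fin 4) :
    ∃ w : (Fin n → Fin 4) → ℝ,
      vqaLoss (efficientSU2Circuit n d e) (zeroState n) (∑ α, (c α : ℂ) • pauliString α) =
        (fun θ => ∑ β, w β * layerExp (fun _ => blochY) β θ) ∧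
      w (if e then pairwisePauli α else α) ^ 2 = c α ^ 2 := by
  cases e with
  | false =>
    refine ⟨c, funext fun θ => ?_, rfl⟩
    simp only [vqaLoss_sum_pauliString, efficientSU2Circuit, Bool.false_eq_true, if_false,
      pauliExp_efficientSU2]
  | true =>
    choose s hs h using fun α : Fin n → Fin 4 => pauliExp_pairwiseLayer_mul α
    refine ⟨fun β => ∑ α with pairwisePauli α = β, c α * s α, funext fun θ => ?_, ?_⟩
    · simp only [vqaLoss_sum_pauliString, efficientSU2Circuit, if_true, h, pauliExp_efficientSU2]
      rw [← Finset.sum_fiberwise Finset.univ pairwisePauli]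
      refine Finset.sum_congr rfl fun β _ => ?_
      rw [Finset.sum_mul]
      refine Finset.sum_congr rfl fun γ hγ => ?_
      rw [(Finset.mem_filter.1 hγ).2, mul_assoc]
    · simp only [if_true]
      -- By injectivity no other Pauli term can cancel the chosen one under the final entangling
      -- layer.
      have : (Finset.univ.filter fun γ : Fin n → Fin 4 => pairwisePauli γ = pairwisePauli α) =
          {α} := by
        ext γ; simp [pairwisePauli_injective.eq_iff]
      rw [this, Finset.sum_singleton, mul_pow, hs, mul_one]

/-- A Pauli term bounds the variances of the loss and of one of its partial derivatives below. -/
lemma le_variance_vqaLoss {n : ℕ} (d : ℕ) (e : Bool) (c : (Fin n → Fin 4) → ℝ)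
    {α : Fin n → Fin 4} {k : ℕ} (h1 : 1 ≤ pauliWeight α) (hk : pauliWeight α ≤ k) :
    c α ^ 2 * (1 / 4 : ℝ) ^ (4 * k * (d + 1)) ≤
      variance (vqaLoss (efficientSU2Circuit n d e) (zeroState n)
        (∑ α, (c α : ℂ) • pauliString α)) (uniformParams (SU2Param n d)) ∧
    ∃ p : SU2Param n d, c α ^ 2 * (1 / 4 : ℝ) ^ (4 * k * (d + 1)) ≤
      variance (partialDeriv p (vqaLoss (efficientSU2Circuit n d e) (zeroState n)
        (∑ α, (c α : ℂ) • pauliString α))) (uniformParams (SU2Param n d)) := by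
  obtain ⟨w, hw, hwα⟩ := exists_vqaLoss_eq_sum_layerExp d e c α
  obtain ⟨S, hcard, hS, hα, hπα⟩ := exists_support_isBlockClosed α
  have hα0 : α ≠ 0 := by
    rintro rfl
    simp [pauliWeight] at h1
  set γ := if e then pairwisePauli α else α with hγ
  have hγS : ∀ j, γ j ≠ 0 → j ∈ S := by
    cases e
    · exact hα
    · exact hπα
  have hγ0 : γ ≠ 0 := by
    cases e
    · exact hα0
    · exact fun h => hα0 (pairwisePauli_injective (h.trans pairwisePauli_zero.symm))
  obtain ⟨i, hi⟩ := Function.ne_iff.1 hγ0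
  have hpow : c α ^ 2 * (1 / 4 : ℝ) ^ (4 * k * (d + 1)) ≤
      w γ ^ 2 * (1 / 4 : ℝ) ^ (S.card * (d + 1)) := by
    rw [hwα]
    refine mul_le_mul_of_nonneg_left (pow_le_pow_of_le_one (by norm_num) (by norm_num) ?_)
      (sq_nonneg _)
    exact Nat.mul_le_mul_right _ (by omega)
  rw [hw]
  refine ⟨hpow.trans (le_variance_sum_layerExp (fun _ => isMixing_blochY) hS hγS hγ0
    (fun _ _ => rfl) w), (Fin.last d, i, 0), ?_⟩
  rw [partialDeriv_sum_layerExp]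
  refine hpow.trans (le_variance_sum_layerExp (fun j => ?_) hS hγS hγ0 (fun j hj => ?_) w)
  · by_cases h : j = i
    · subst h; rw [Function.update_self]; exact isMixing_blochYDeriv
    · rw [Function.update_of_ne h]; exact isMixing_blochY
  -- The differentiated qubit `i` lies in the support of γ; elsewhere the derivative would kill the
  -- identity factor.
  · rw [Function.update_of_ne (by rintro rfl; exact hi hj)]

/-! ### Asymptotics in the number of qubits. -/

lemma exists_pow_le_of_isBigO_log {d : ℕ → ℕ}
    (hd : (fun n => (d n : ℝ)) =O[atTop] fun n : ℕ => Real.log n) :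
    ∃ P : ℕ, ∀ᶠ n : ℕ in atTop, (4 : ℝ) ^ d n ≤ (n : ℝ) ^ P := by
  obtain ⟨C, hC⟩ := hd.bound
  refine ⟨⌈C * Real.log 4⌉₊, ?_⟩
  filter_upwards [hC, eventually_ge_atTop 1] with n hn h1
  have hn0 : (0 : ℝ) < n := by exact_mod_cast h1
  have hlog : 0 ≤ Real.log n := Real.log_nonneg (by exact_mod_cast h1)
  rw [Real.norm_of_nonneg (Nat.cast_nonneg _), Real.norm_of_nonneg hlog] at hn
  rw [← Real.log_le_log_iff (by positivity) (by positivity), Real.log_pow, Real.log_pow]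
  calc (d n : ℝ) * Real.log 4 ≤ C * Real.log n * Real.log 4 :=
        mul_le_mul_of_nonneg_right hn (Real.log_nonneg (by norm_num))
    _ = C * Real.log 4 * Real.log n := by ring
    _ ≤ _ := mul_le_mul_of_nonneg_right (Nat.le_ceil _) hlog

lemma exists_invPoly_le {c : ℕ → ℝ} (hc : IsOmegaInvPoly c) {d : ℕ → ℕ}
    (hd : (fun n => (d n : ℝ)) =O[atTop] fun n : ℕ => Real.log n) (k : ℕ) :
    ∃ (A : ℝ) (Q : ℕ), 0 < A ∧
      ∀ᶠ n : ℕ in atTop, 1 / (n : ℝ) ^ Q ≤ A * (c n ^ 2 * (1 / 4 : ℝ) ^ (4 * k * (d n + 1))) := by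
  obtain ⟨p, hp⟩ := hc
  obtain ⟨K, hK, hp⟩ := hp.exists_pos
  obtain ⟨P, hP⟩ := exists_pow_le_of_isBigO_log hd
  -- The factor 4^(4k) absorbs the rotation layer beyond the d repetitions; the remaining 4^(-4kd)
  -- is at least n^(-4kP), and squaring the coefficient gives K² and 2p.
  refine ⟨K ^ 2 * 4 ^ (4 * k), 2 * p + P * (4 * k), by positivity, ?_⟩
  filter_upwards [hp.bound, hP, eventually_ge_atTop 1] with n hn hPn h1
  have hn0 : (0 : ℝ) < n := by exact_mod_cast h1
  rw [Real.norm_of_nonneg (by positivity), Real.norm_eq_abs] at hn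
  have hsq : 1 / (n : ℝ) ^ (2 * p) ≤ K ^ 2 * c n ^ 2 := by
    have := pow_le_pow_left₀ (by positivity) hn 2
    rwa [mul_pow, sq_abs, div_pow, one_pow, ← pow_mul, mul_comm p 2] at this
  have hpow : 1 / (n : ℝ) ^ (P * (4 * k)) ≤ 4 ^ (4 * k) * (1 / 4 : ℝ) ^ (4 * k * (d n + 1)) := by
    have h2 : (4 : ℝ) ^ (4 * k) * (1 / 4 : ℝ) ^ (4 * k * (d n + 1)) =
        1 / ((4 : ℝ) ^ d n) ^ (4 * k) := by
      rw [mul_add, mul_one, pow_add, one_div_pow, one_div_pow, ← pow_mul, mul_comm (d n)]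
      field_simp
    rw [h2, pow_mul]
    exact one_div_le_one_div_of_le (by positivity) (pow_le_pow_left₀ (by positivity) hPn _)
  calc 1 / (n : ℝ) ^ (2 * p + P * (4 * k)) =
        1 / (n : ℝ) ^ (2 * p) * (1 / (n : ℝ) ^ (P * (4 * k))) := by
        rw [pow_add]; field_simp
    _ ≤ K ^ 2 * c n ^ 2 * (4 ^ (4 * k) * (1 / 4 : ℝ) ^ (4 * k * (d n + 1))) :=
        mul_le_mul hsq hpow (by positivity) (by positivity)
    _ = _ := by ring

lemma not_eventually_invPoly_le_exp (A C : ℝ) (Q : ℕ) {b : ℝ} (hb : 1 < b) :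
    ¬ ∀ᶠ n : ℕ in atTop, 1 / (n : ℝ) ^ Q ≤ A * (C / b ^ n) := by
  intro h
  have ht := (tendsto_pow_const_div_const_pow_of_one_lt Q hb).const_mul (A * C)
  rw [mul_zero] at ht
  obtain ⟨n, h1, h2, h3⟩ :=
    (h.and ((ht.eventually (gt_mem_nhds one_pos)).and (eventually_ge_atTop 1))).exists
  have hn0 : (0 : ℝ) < n := by exact_mod_cast h3
  rw [div_le_iff₀ (by positivity)] at h1
  have : A * (C / b ^ n) * (n : ℝ) ^ Q = A * C * ((n : ℝ) ^ Q / b ^ n) := by ring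
  linarith

end

theorem corollary1
    (H : (n : ℕ) → QOp n) (hH : ∀ n, (H n).IsHermitian) (hmixed : IsMixed H)
    (d : ℕ → ℕ) (hd : (fun n => (d n : ℝ)) =O[atTop] fun n : ℕ => Real.log n)
    (e : ℕ → Bool) :
    IsOmegaInvPoly (fun n =>
      variance (vqaLoss (efficientSU2Circuit n (d n) (e n)) (zeroState n) (H n))
        (uniformParams (SU2Param n (d n)))) ∧
    ¬ HasBarrenPlateau (fun n =>
      vqaLoss (efficientSU2Circuit n (d n) (e n)) (zeroState n) (H n)) := by
  obtain ⟨c, hHc, k, α, hα, hc⟩ := hmixed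
  obtain ⟨A, Q, hA, hAQ⟩ := exists_invPoly_le hc hd k
  have hvar := hα.mono fun n h => le_variance_vqaLoss (d n) (e n) (c n) h.1 h.2
  simp only [← hHc] at hvar
  refine ⟨⟨Q, Asymptotics.IsBigO.of_bound A ?_⟩, ?_⟩
  · filter_upwards [hvar, hAQ] with n hn hQ
    rw [Real.norm_of_nonneg (by positivity), Real.norm_of_nonneg (variance_nonneg _ _)]
    exact hQ.trans (mul_le_mul_of_nonneg_left hn.1 hA.le)
  · rintro ⟨b, hb, C, hC⟩
    refine not_eventually_invPoly_le_exp A C Q hb ?_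
    filter_upwards [hvar, hAQ, hC] with n hn hQ hCn
    obtain ⟨p, hp⟩ := hn.2
    exact hQ.trans (mul_le_mul_of_nonneg_left (hp.trans (hCn p)) hA.le)
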